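/- Let $k$ be a field and $\mathfrak a$ a $k$-linear category. **Hochschild cohomology.** For a $\mathbb Z$-graded $k$-quiver $\mathfrak q$ (a set of objects with a graded $k$-module $\mathfrak q(A,A')$ for any two objects), let $\mathbf C(\mathfrak q)=\prod_{n\ge 0}\prod_{A_0,\dots,A_n}\mathrm{Hom}_k\big(\mathfrak q(A_{n-1},A_n)\otimes\cdots\otimes\mathfrak q(A_0,A_1),\,\mathfrak q(A_0,A_n)\big)$, where a map with $n$ arguments and internal degree $i$ has degree $n+i$. Identify such a map $\phi$ with a map of degree $n+i-1$ on the shifted modules $\Sigma\mathfrak q$, by the sign $(-1)^{ni+(n-1)|f_n|+\cdots+|f_2|}$ on arguments $(f_n,\dots,f_1)$. On the shifted maps, $\phi\{\psi_1,\dots,\psi_m\}$ is the brace operation: the sum, with Koszul signs, over all insertions of $\psi_1,\dots,\psi_m$ (in this order) into $\phi$. Regard $\mathfrak a$ as a quiver in degree $0$, with composition $m\in\mathbf C^2(\mathfrak a)$. Then $\mathbf C(\mathfrak a)$ is the Hochschild complex with differential $\langle m,-\rangle$, where $\langle x,y\rangle=x\{y\}-(-1)^{|x||y|}y\{x\}$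 (shifted degrees), and $HH^2(\mathfrak a)$ is its second cohomology. **The characteristic morphism.** Let $\mathsf{Com}(\mathfrak a)$ be the dg category of complexes over $\mathfrak a$, $K(\mathfrak a)$ its homotopy category, and $\mathsf{PCom}(\mathfrak a)$ the graded quiver of precomplexes $(C,\delta_C)$ ($\delta_C$ any degree-one endomorphism of the graded object $C$), with $\mathsf{PCom}(\mathfrak a)(C,D)^n=\prod_p\mathfrak a(C^p,D^{p+n})$. Extend $\phi\in\mathbf C^n(\mathfrak a)$ componentwise to $\mathsf{PCom}(\mathfrak a)$, let $\delta=(\delta_C)_C\in\mathbf C^1(\mathsf{PCom}(\mathfrak a))$, and put $\mathrm{embr}_\delta(\phi)=\sum_{j=0}^n\phi\{\delta^{\otimes j}\}$. The lifted characteristic morphism is $$\bar\chi_{\mathfrak a}:\mathbf C^n(\mathfrak a)\to\prod_{C\in\mathsf{Com}(\mathfrak a)}\mathsf{Com}(\mathfrak a)^n(C,C),$$ where $\bar\chi_{\mathfrak a}(\phi)_C$ is the part with no arguments of $\mathrm{embr}_\delta(\phi)$ at $C$. In cohomology it induces the characteristic morphism $\chi_{\mathfrak a}:HH^2(\mathfrak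 a)\to\mathfrak Z^2K(\mathfrak a)$, where $\mathfrak Z^nK(\mathfrak a)$ is the degree-$n$ part of the graded centre: the families $(\zeta_C\in K(\mathfrak a)(C,C[n]))_C$ with $\zeta_Df=(-1)^{mn}f\zeta_C$ for all $f\in K(\mathfrak a)(C,D[m])$. **Deformations and obstructions.** For a Hochschild $2$-cocycle $\phi$ representing $c\in HH^2(\mathfrak a)$, let $\mathfrak a_\phi[\epsilon]$ be the first order deformation of $\mathfrak a$ (a $k[\epsilon]$-linear category, $\epsilon^2=0$) with the objects of $\mathfrak a$, morphism modules $\mathfrak a(A,A')[\epsilon]$ and composition $m+\phi\epsilon$; this is the deformation $\mathfrak a_c[\epsilon]$. For a complex $C=(C,\delta_C)$ over $\mathfrak a$, a graded lift of $C$ is a degree-one endomorphism $\bar\delta$ over $\mathfrak a_\phi[\epsilon]$ of the graded object $C$ that reduces to $\delta_C$ modulo $\epsilon$. Graded lifts exist. The curvature of a graded lift is of the form $-\bar\delta^2=u\,\epsilon$ with $u\in\mathsf{Com}(\mathfrak a)^2(C,C)$ a cocycle. The obstruction $o_C\in K(\mathfrak a)(C,C[2])$ to lifting $C$ to an object of $K(\mathfrak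 a_c[\epsilon])$ is the class of $u$. **Theorem.** 1. For every $\phi\in\mathbf C^2(\mathfrak a)$ and every complex $C$ over $\mathfrak a$, $\ \bar\chi_{\mathfrak a}(\phi)_C=-\phi(\delta_C,\delta_C)$. 2. For every $c\in HH^2(\mathfrak a)$, every cocycle $\phi$ representing $c$ and every $C\in K(\mathfrak a)$, the class $o_C$ does not depend on the graded lift, and $\chi_{\mathfrak a}(c)_C=o_C$; that is, $\chi_{\mathfrak a}(c)=(o_C)_{C\in K(\mathfrak a)}$. 3. In the situation of 2, $\chi_{\mathfrak a}(c)_C=0$ if and only if $C$ lifts along $k\otimes_{k[\epsilon]}-:K(\mathfrak a_\phi[\epsilon])\to K(\mathfrak a)$, i.e. there is $D\in K(\mathfrak a_\phi[\epsilon])$ with $k\otimes_{k[\epsilon]}D\cong C$ in $K(\mathfrak a)$. -/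

import Mathlib

open CategoryTheory

universe w v u

noncomputable section

namespace HochChar


/-- A graded `k`-quiver: a set of objects and a `ℤ`-graded `k`-module of morphisms between any two
objects. The graded module is given by its homogeneous parts `gr A B n`, realised as submodules of
an ambient module `Hom A B`; only the homogeneous parts are used. -/
structure GradedQuiver (k : Type w) [CommRing k] where
  Ob : Type u
  Hom : Ob → Ob → Type v
  [addCommGroup : ∀ A B, AddCommGroup (Hom A B)]
  [module : ∀ A B, Module k (Hom A B)]
  gr : ∀ A B, ℤ → Submodule k (Hom A B)

instance {k : Type w} {_ : CommRing k} (Q : GradedQuiver.{w, v, u} k) (A B : Q.Ob) :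
    AddCommGroup (Q.Hom A B) := Q.addCommGroup A B

instance {k : Type w} {_ : CommRing k} (Q : GradedQuiver.{w, v, u} k) (A B : Q.Ob) :
    Module k (Q.Hom A B) := Q.module A B

namespace GradedQuiver

variable {k : Type w} [CommRing k] (Q : GradedQuiver.{w, v, u} k)

/-- Chains of composable homogeneous elements `A₀ → A₁ → ⋯ → Aₙ`. The chain `cons f₁ (cons f₂ ⋯)`
starts at `A₀` with `f₁ : A₀ → A₁`; in the order of composition it is `(fₙ, …, f₁)`. Empty chains
at an object are included. -/
inductive Chain : Q.Ob → Q.Ob → Type (max u v)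
  | nil (A : Q.Ob) : Chain A A
  | cons {A B C : Q.Ob} (d : ℤ) (f : Q.gr A B d) (c : Chain B C) : Chain A C

variable {Q}

namespace Chain

/-- The number `n` of elements of a chain. -/
def length : {A B : Q.Ob} → Q.Chain A B → ℤ
  | _, _, nil _ => 0
  | _, _, cons _ _ c => length c + 1

/-- The total degree `|f₁| + ⋯ + |fₙ|`. -/
def deg : {A B : Q.Ob} → Q.Chain A B → ℤ
  | _, _, nil _ => 0
  | _, _, cons d _ c => d + deg c

/-- The number `(n - 1)|fₙ| + ⋯ + 2|f₃| + |f₂|` that occurs in the sign rule for (de)suspension. -/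
def weight : {A B : Q.Ob} → Q.Chain A B → ℤ
  | _, _, nil _ => 0
  | _, _, cons _ _ c => weight c + deg c

/-- Concatenation of chains. -/
def append : {A B C : Q.Ob} → Q.Chain A B → Q.Chain B C → Q.Chain A C
  | _, _, _, nil _, c' => c'
  | _, _, _, cons d f c, c' => cons d f (append c c')

/-- All ways to write a chain as a concatenation of two chains. -/
def splits : {A C : Q.Ob} → Q.Chain A C → List ((B : Q.Ob) × Q.Chain A B × Q.Chain B C)
  | _, _, nil A => [⟨A, nil A, nil A⟩]
  | A, _, cons d f c => ⟨A, nil A, cons d f c⟩ ::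
      (splits c).map fun s => ⟨s.1, cons d f s.2.1, s.2.2⟩

/-- The degree of `(σfₙ, …, σf₁)` in the bar construction, where `σ` lowers the degree by one. -/
def bdeg {A B : Q.Ob} (c : Q.Chain A B) : ℤ := c.deg - c.length

@[simp] lemma bdeg_nil (A : Q.Ob) : (nil A).bdeg = 0 := rfl
@[simp] lemma bdeg_cons {A B C : Q.Ob} (d : ℤ) (f : Q.gr A B d) (c : Q.Chain B C) :
    (cons d f c).bdeg = d - 1 + c.bdeg := by simp only [bdeg, deg, length]; ring

@[simp] lemma bdeg_append {A B C : Q.Ob} (c : Q.Chain A B) (c' : Q.Chain B C) :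
    (c.append c').bdeg = c.bdeg + c'.bdeg := by
  induction c with
  | nil => simp [append]
  | cons d f c ih => simp [append, ih, add_assoc]

lemma deg_append {A B C : Q.Ob} (c : Q.Chain A B) (c' : Q.Chain B C) :
    (c.append c').deg = c.deg + c'.deg := by
  induction c with
  | nil => simp [append, deg]
  | cons d f c ih => simp [append, deg, ih, add_assoc]

lemma length_append {A B C : Q.Ob} (c : Q.Chain A B) (c' : Q.Chain B C) :
    (c.append c').length = c.length + c'.length := by
  induction c with
  | nil => simp [append, length]
  | cons d f c ih => simp only [append, length, ih]; ring

lemma append_assoc {A B C D : Q.Ob} (c : Q.Chain A B) (c' : Q.Chain B C) (c'' : Q.Chain C D) :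
    (c.append c').append c'' = c.append (c'.append c'') := by
  induction c with
  | nil => rfl
  | cons d f c ih => simp [append, ih]

lemma append_of_mem_splits {A C : Q.Ob} {c : Q.Chain A C} :
    ∀ s ∈ c.splits, s.2.1.append s.2.2 = c := by
  induction c with
  | nil => simp [splits, append]
  | cons d f c ih =>
    intro s hs
    simp only [splits, List.mem_cons, List.mem_map] at hs
    rcases hs with rfl | ⟨t, ht, rfl⟩
    · rfl
    · simp [append, ih t ht]

end Chain

variable (Q)

/-- Families of (not necessarily multilinear) maps on chains, of every length. -/
abbrev Raw := ∀ A B : Q.Ob, Q.Chain A B → Q.Hom A B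

instance : AddCommGroup Q.Raw := Pi.addCommGroup

instance : AddCommMonoid Q.Raw := AddCommGroup.toAddCommMonoid

instance : Module k Q.Raw := Pi.module _ _ _

open Chain

/-- The degree `p` part `C^p(Q)` of the Hochschild object
`∏_{n ≥ 0} ∏_{A₀, …, Aₙ} Hom(Q(Aₙ₋₁, Aₙ) ⊗ ⋯ ⊗ Q(A₀, A₁), Q(A₀, Aₙ))` of a graded quiver.
An element is given by its values on chains; it is linear in each slot, and the component with `n`
arguments has internal degree `p - n`, that is, it sends a chain `c` to degree `bdeg c + p`. -/
def cochains (p : ℤ) : Submodule k Q.Raw where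
  carrier := {φ | (∀ (A B : Q.Ob) (c : Q.Chain A B), φ A B c ∈ Q.gr A B (c.bdeg + p)) ∧
    ∀ (A B C D : Q.Ob) (c : Q.Chain A B) (d : ℤ) (c' : Q.Chain C D),
      IsLinearMap k fun f : Q.gr B C d => φ A D (c.append (cons d f c'))}
  add_mem' := fun {φ ψ} hφ hψ => ⟨fun A B c => add_mem (hφ.1 A B c) (hψ.1 A B c),
    fun A B C D c d c' => ⟨fun f g => by
      simp only [Pi.add_apply, (hφ.2 A B C D c d c').map_add, (hψ.2 A B C D c d c').map_add]; abel,
      fun r f => by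
      simp only [Pi.add_apply, (hφ.2 A B C D c d c').map_smul, (hψ.2 A B C D c d c').map_smul,
        smul_add]⟩⟩
  zero_mem' := ⟨fun _ _ _ => zero_mem _, fun _ _ _ _ _ _ _ => ⟨fun _ _ => by simp, fun _ _ => by simp⟩⟩
  smul_mem' := fun r φ hφ => ⟨fun A B c => Submodule.smul_mem _ r (hφ.1 A B c),
    fun A B C D c d c' => ⟨fun f g => by
      simp only [Pi.smul_apply, (hφ.2 A B C D c d c').map_add, smul_add],
      fun s f => by
      simp only [Pi.smul_apply, (hφ.2 A B C D c d c').map_smul, smul_comm r s]⟩⟩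

variable {Q}

/-- A cochain together with its degree. -/
abbrev SomeCochain (Q : GradedQuiver.{w, v, u} k) := (p : ℤ) × Q.cochains p

/-- All ways to insert the values of `ψs` on disjoint consecutive subchains into a chain. The list `ψs`
is read from the source side. An inserted `ψ`, of bar degree `p - 1`, passes the elements to the left
of its place in the order of composition, which are those that come later in the chain; this gives
the Koszul sign. -/
def insertions : List (SomeCochain Q) → {A C : Q.Ob} → Q.Chain A C → List (ℤˣ × Q.Chain A C)
  | [], _, _, c => [(1, c)]
  | ψ :: ψs, _, _, c => c.splits.flatMap fun s => s.2.2.splits.flatMap fun t =>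
      (insertions ψs t.2.2).map fun x =>
        (((ψ.1 - 1) * t.2.2.bdeg).negOnePow * x.1,
          s.2.1.append (cons (t.2.1.bdeg + ψ.1) ⟨ψ.2.1 _ _ t.2.1, ψ.2.2.1 _ _ t.2.1⟩ x.2))

/-- The values of the brace operation. -/
def braceRaw {p : ℤ} (φ : Q.cochains p) (ψs : List (SomeCochain Q)) : Q.Raw := fun A B c =>
  ((insertions ψs.reverse c).map fun x => x.1 • φ.1 A B x.2).sum

lemma bdeg_of_mem_insertions (ψs : List (SomeCochain Q)) {A C : Q.Ob} (c : Q.Chain A C) :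
    ∀ x ∈ insertions ψs c, x.2.bdeg = c.bdeg + (ψs.map fun ψ => ψ.1 - 1).sum := by
  induction ψs generalizing A C with
  | nil => simp [insertions]
  | cons ψ ψs ih =>
    intro x hx
    simp only [insertions, List.mem_flatMap, List.mem_map] at hx
    obtain ⟨s, hs, t, ht, y, hy, rfl⟩ := hx
    have h1 := congrArg bdeg (append_of_mem_splits s hs)
    have h2 := congrArg bdeg (append_of_mem_splits t ht)
    simp only [bdeg_append, bdeg_cons, List.map_cons, List.sum_cons] at h1 h2 ⊢
    rw [ih _ y hy]
    linarith

section
variable {M : Type*} [AddCommGroup M]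

lemma sum_splits_append {A B C : Q.Ob} (c : Q.Chain A B) (d : ℤ) {B' : Q.Ob} (f : Q.gr B B' d)
    (c' : Q.Chain B' C) (G : (D : Q.Ob) × Q.Chain A D × Q.Chain D C → M) :
    ((c.append (cons d f c')).splits.map G).sum =
      (c.splits.map fun s => G ⟨s.1, s.2.1, s.2.2.append (cons d f c')⟩).sum +
      (c'.splits.map fun s => G ⟨s.1, c.append (cons d f s.2.1), s.2.2⟩).sum := by
  induction c with
  | nil A =>
    simp [append, splits, Function.comp_def]
  | cons e g c ih =>
    simp only [append, splits, List.map_cons, List.sum_cons, List.map_map, Function.comp_def]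
    rw [ih f (fun s => G ⟨s.1, cons e g s.2.1, s.2.2⟩)]
    simp [append, add_assoc]

end

lemma isLinearMap_list_sum {k M N ι : Type*} [CommRing k] [AddCommGroup M] [AddCommGroup N] [Module k M] [Module k N]
    (l : List ι) (F : ι → M → N) (h : ∀ i ∈ l, IsLinearMap k (F i)) :
    IsLinearMap k fun m => (l.map fun i => F i m).sum := by
  induction l with
  | nil => exact ⟨by simp, by simp⟩
  | cons i l ih =>
    have h1 := h i (by simp)
    have h2 := ih fun j hj => h j (by simp [hj])
    exact ⟨fun x y => by simp only [List.map_cons, List.sum_cons, h1.map_add, h2.map_add]; abel,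
      fun r x => by simp only [List.map_cons, List.sum_cons, h1.map_smul, h2.map_smul, smul_add]⟩

lemma isLinearMap_units_smul {k M N : Type*} [CommRing k] [AddCommGroup M] [AddCommGroup N] [Module k M] [Module k N]
    (s : ℤˣ) {F : M → N} (h : IsLinearMap k F) : IsLinearMap k fun m => s • F m :=
  ⟨fun x y => by rw [h.map_add, smul_add], fun r x => by
    rw [h.map_smul]; simp only [Units.smul_def]; rw [smul_comm]⟩

lemma isLinearMap_add {k M N : Type*} [CommRing k] [AddCommGroup M] [AddCommGroup N] [Module k M] [Module k N]
    {F G : M → N} (h : IsLinearMap k F) (h' : IsLinearMap k G) : IsLinearMap k fun m => F m + G m :=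
  ⟨fun x y => by rw [h.map_add, h'.map_add]; abel, fun r x => by
    rw [h.map_smul, h'.map_smul, smul_add]⟩

lemma cons_congr {A B C : Q.Ob} {d d' : ℤ} (h : d = d') (x : Q.Hom A B) (hx : x ∈ Q.gr A B d)
    (c : Q.Chain B C) : (cons d ⟨x, hx⟩ c : Q.Chain A C) = cons d' ⟨x, h ▸ hx⟩ c := by
  subst h; rfl

lemma sum_flatMap_map {α β M : Type*} [AddCommMonoid M] (l : List α) (g : α → List β) (h : β → M) :
    ((l.flatMap g).map h).sum = (l.map fun i => ((g i).map h).sum).sum := by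
  induction l with
  | nil => simp
  | cons a l ih => simp [ih]

lemma sum_insertions_cons {M : Type*} [AddCommGroup M] (ψ : SomeCochain Q)
    (ψs : List (SomeCochain Q)) {A C : Q.Ob} (c : Q.Chain A C) (F : Q.Chain A C → M) :
    ((insertions (ψ :: ψs) c).map fun x => x.1 • F x.2).sum =
      (c.splits.map fun s => (s.2.2.splits.map fun t =>
        ((ψ.1 - 1) * t.2.2.bdeg).negOnePow • ((insertions ψs t.2.2).map fun x => x.1 •
          F (s.2.1.append (cons (t.2.1.bdeg + ψ.1) ⟨ψ.2.1 _ _ t.2.1, ψ.2.2.1 _ _ t.2.1⟩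
            x.2))).sum).sum).sum := by
  simp only [insertions, sum_flatMap_map, List.map_map, Function.comp_def, mul_smul,
    List.smul_sum]

lemma insertions_linear (ψs : List (SomeCochain Q)) {A B C D : Q.Ob} (c : Q.Chain A B) (d : ℤ)
    (c' : Q.Chain C D) {M : Type*} [AddCommGroup M] [Module k M] (F : Q.Chain A D → M)
    (hF : ∀ (A' B' : Q.Ob) (e : Q.Chain A A') (n : ℤ) (e' : Q.Chain B' D),
      IsLinearMap k fun f : Q.gr A' B' n => F (e.append (cons n f e'))) :
    IsLinearMap k fun f : Q.gr B C d =>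
      ((insertions ψs (c.append (cons d f c'))).map fun x => x.1 • F x.2).sum := by
  induction ψs generalizing A B C D d c c' with
  | nil => simpa [insertions] using hF B C c d c'
  | cons ψ ψs ih =>
    simp only [sum_insertions_cons, sum_splits_append]
    refine isLinearMap_add (isLinearMap_list_sum _ _ fun s _ => isLinearMap_add
      (isLinearMap_list_sum _ _ fun t _ => ?_) (isLinearMap_list_sum _ _ fun t _ => ?_))
      (isLinearMap_list_sum _ _ fun s _ => isLinearMap_list_sum _ _ fun t _ => ?_)
    · simp only [bdeg_append, bdeg_cons]
      refine isLinearMap_units_smul _ (ih t.2.2 d c' (fun y => F (s.2.1.append (cons (t.2.1.bdeg + ψ.1)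
        ⟨ψ.2.1 _ _ t.2.1, ψ.2.2.1 _ _ t.2.1⟩ y))) ?_)
      intro A' B' e n e'
      simpa only [append_assoc, append] using hF A' B' (s.2.1.append (cons (t.2.1.bdeg + ψ.1)
        ⟨ψ.2.1 _ _ t.2.1, ψ.2.2.1 _ _ t.2.1⟩ e)) n e'
    · refine isLinearMap_units_smul _ (isLinearMap_list_sum _ _ fun x _ =>
        isLinearMap_units_smul _ ?_)
      have hdeg : ∀ f : Q.gr B C d, (s.2.2.append (cons d f t.2.1)).bdeg + ψ.1 =
          s.2.2.bdeg + (d - 1 + t.2.1.bdeg) + ψ.1 := fun f => by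
        simp only [bdeg_append, bdeg_cons]
      have h1 := hF _ _ s.2.1 (s.2.2.bdeg + (d - 1 + t.2.1.bdeg) + ψ.1) x.2
      have h2 := ψ.2.2.2 _ _ _ _ s.2.2 d t.2.1
      have h3 : ∀ f : Q.gr B C d, ψ.2.1 _ _ (s.2.2.append (cons d f t.2.1)) ∈
          Q.gr s.1 t.1 (s.2.2.bdeg + (d - 1 + t.2.1.bdeg) + ψ.1) := fun f =>
        hdeg f ▸ ψ.2.2.1 _ _ _
      have h4 : ∀ f : Q.gr B C d, F (s.2.1.append (cons
          ((s.2.2.append (cons d f t.2.1)).bdeg + ψ.1) ⟨ψ.2.1 _ _ (s.2.2.append (cons d f t.2.1)),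
            ψ.2.2.1 _ _ _⟩ x.2)) = F (s.2.1.append (cons _ ⟨_, h3 f⟩ x.2)) := fun f => by
        rw [cons_congr (hdeg f)]
      simp only [h4]
      refine ⟨fun f g => ?_, fun r f => ?_⟩
      · rw [← h1.map_add]
        congr 3
        exact Subtype.ext (h2.map_add f g)
      · rw [← h1.map_smul]
        congr 3
        exact Subtype.ext (h2.map_smul r f)
    · refine isLinearMap_units_smul _ (isLinearMap_list_sum _ _ fun x _ =>
        isLinearMap_units_smul _ ?_)
      simp only [append_assoc, append]
      exact hF _ _ c d (s.2.1.append (cons (t.2.1.bdeg + ψ.1) ⟨ψ.2.1 _ _ t.2.1, ψ.2.2.1 _ _ t.2.1⟩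
        x.2))

lemma braceRaw_mem {p q : ℤ} (φ : Q.cochains p) (ψs : List (SomeCochain Q))
    (h : p + (ψs.map fun ψ => ψ.1 - 1).sum = q) : braceRaw φ ψs ∈ Q.cochains q := by
  refine ⟨fun A B c => list_sum_mem fun y hy => ?_, fun A B C D c d c' => ?_⟩
  · obtain ⟨x, hx, rfl⟩ := List.mem_map.1 hy
    have h1 := φ.2.1 _ _ x.2
    rw [bdeg_of_mem_insertions _ c x hx, List.map_reverse, List.sum_reverse] at h1
    rw [show c.bdeg + q = c.bdeg + (ψs.map fun ψ => ψ.1 - 1).sum + p by linarith, Units.smul_def]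
    exact zsmul_mem h1 _
  · exact insertions_linear _ c d c' (φ.1 A D) fun A' B' e n e' => φ.2.2 _ _ _ _ e n e'

/-- The brace `φ{ψ₁, …, ψₘ}` of bar cochains: the sum over all insertions of `ψ₁, …, ψₘ`, in this
order of composition, with Koszul signs. Bar cochains are stored in the same modules
`cochains p`, the degree in the bar construction being `p - 1`. -/
def brace {p : ℤ} (φ : Q.cochains p) (ψs : List (SomeCochain Q)) (q : ℤ)
    (h : p + (ψs.map fun ψ => ψ.1 - 1).sum = q) : Q.cochains q :=
  ⟨braceRaw φ ψs, braceRaw_mem φ ψs h⟩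

/-- The bracket `⟨x, y⟩ = x{y} - (-1)^{|x||y|} y{x}`, with bar degrees `|x| = p - 1`, `|y| = q - 1`. -/
def bracket {p q : ℤ} (x : Q.cochains p) (y : Q.cochains q) (r : ℤ) (h : p + (q - 1) = r) :
    Q.cochains r :=
  brace x [⟨q, y⟩] r (by simpa using h) -
    ((p - 1) * (q - 1)).negOnePow • brace y [⟨p, x⟩] r (by simp; linarith)

lemma brace_add {p : ℤ} (φ φ' : Q.cochains p) (ψs : List (SomeCochain Q)) (q : ℤ) (h) :
    brace (φ + φ') ψs q h = brace φ ψs q h + brace φ' ψs q h := by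
  ext A B c
  simp [brace, braceRaw, List.sum_map_add]

lemma brace_smul {p : ℤ} (r : k) (φ : Q.cochains p) (ψs : List (SomeCochain Q)) (q : ℤ) (h) :
    brace (r • φ) ψs q h = r • brace φ ψs q h := by
  ext A B c
  simp only [brace, braceRaw, Submodule.coe_smul, Pi.smul_apply, List.smul_sum, List.map_map]
  congr 2
  ext x
  simp only [Function.comp_apply, Units.smul_def]
  rw [smul_comm]

lemma isLinearMap_brace_singleton {p q : ℤ} (x : Q.cochains p) (r : ℤ)
    (h : p + (q - 1) = r) :
    IsLinearMap k fun y : Q.cochains q => brace x [⟨q, y⟩] r (by simpa using h) := by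
  have key : ∀ (A B : Q.Ob) (c : Q.Chain A B),
      IsLinearMap k fun y : Q.cochains q => braceRaw x [⟨q, y⟩] A B c := by
    intro A B c
    simp only [braceRaw, List.reverse_singleton, sum_insertions_cons]
    refine isLinearMap_list_sum _ _ fun s _ => isLinearMap_list_sum _ _ fun t _ =>
      isLinearMap_units_smul _ ?_
    simp only [insertions, List.map_cons, List.map_nil, List.sum_cons, List.sum_nil, add_zero,
      one_smul]
    have h1 := x.2.2 _ _ _ _ s.2.1 (t.2.1.bdeg + q) t.2.2
    exact ⟨fun y z => h1.map_add ⟨_, y.2.1 _ _ t.2.1⟩ ⟨_, z.2.1 _ _ t.2.1⟩,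
      fun a y => h1.map_smul a ⟨_, y.2.1 _ _ t.2.1⟩⟩
  exact ⟨fun y z => Subtype.ext <| funext fun A => funext fun B => funext fun c =>
      (key A B c).map_add y z, fun a y => Subtype.ext <| funext fun A => funext fun B =>
      funext fun c => (key A B c).map_smul a y⟩

lemma weight_append_cons {A B C D : Q.Ob} (c : Q.Chain A B) (d : ℤ) (f g : Q.gr B C d)
    (c' : Q.Chain C D) : (c.append (cons d f c')).weight = (c.append (cons d g c')).weight := by
  induction c with
  | nil => rfl
  | cons e h c ih => simp only [append, weight, deg_append, deg, ih f g]

/-- The sign `(-1)^{n i + (n - 1)|fₙ| + ⋯ + |f₂|}` that relates a cochain with `n` arguments and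
internal degree `i = p - n` to the corresponding bar cochain. -/
def suspSign (p : ℤ) {A B : Q.Ob} (c : Q.Chain A B) : ℤˣ :=
  (c.length * (p - c.length) + c.weight).negOnePow

/-- The passage between cochains and bar cochains; it is an involution. -/
def susp (p : ℤ) : Q.cochains p →ₗ[k] Q.cochains p where
  toFun φ := ⟨fun A B c => suspSign p c • φ.1 A B c, by
    refine ⟨fun A B c => ?_, fun A B C D c d c' => ?_⟩
    · change suspSign p c • φ.1 A B c ∈ _
      rw [Units.smul_def]
      exact zsmul_mem (φ.2.1 A B c) _
    · have h : ∀ f : Q.gr B C d, suspSign p (c.append (cons d f c')) =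
          suspSign p (c.append (cons d 0 c')) := fun f => by
        simp only [suspSign, length_append, length, weight_append_cons c d f 0 c']
      simp only [h]
      exact isLinearMap_units_smul _ (φ.2.2 _ _ _ _ c d c')⟩
  map_add' φ ψ := by ext A B c; simp
  map_smul' r φ := by ext A B c; simp [Units.smul_def, smul_comm r]

/-- The Hochschild differential `φ ↦ ⟨μ, φ⟩`, computed on bar cochains, for an `A_∞`-structure given
by a cochain `μ` of degree two. -/
def differential (μ : Q.cochains 2) (p q : ℤ) (h : p + 1 = q) : Q.cochains p →ₗ[k] Q.cochains q where
  toFun φ := susp q (bracket (susp 2 μ) (susp p φ) q (by linarith))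
  map_add' φ ψ := by
    simp only [bracket, map_add, (isLinearMap_brace_singleton _ _ (show 2 + (p - 1) = q by linarith)).map_add,
      brace_add, smul_add, map_sub]
    abel
  map_smul' r φ := by
    simp only [bracket, map_smul, (isLinearMap_brace_singleton _ _ (show 2 + (p - 1) = q by linarith)).map_smul, brace_smul,
      map_sub, Units.smul_def, RingHom.id_apply, smul_sub]
    simp only [smul_comm r, map_smul, map_zsmul]

/-- Hochschild cocycles of degree `p`. -/
def cocycles (μ : Q.cochains 2) (p : ℤ) : Submodule k (Q.cochains p) :=
  LinearMap.ker (differential μ p (p + 1) rfl)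

/-- Hochschild coboundaries of degree `p`. -/
def coboundaries (μ : Q.cochains 2) (p : ℤ) : Submodule k (Q.cochains p) :=
  LinearMap.range (differential μ (p - 1) p (sub_add_cancel p 1))

/-- Hochschild cohomology in degree `p`. -/
def HH (μ : Q.cochains 2) (p : ℤ) : Type _ :=
  cocycles μ p ⧸ (coboundaries μ p).submoduleOf (cocycles μ p)

instance (μ : Q.cochains 2) (p : ℤ) : AddCommGroup (HH μ p) :=
  inferInstanceAs (AddCommGroup (cocycles μ p ⧸ (coboundaries μ p).submoduleOf (cocycles μ p)))

instance (μ : Q.cochains 2) (p : ℤ) : Module k (HH μ p) :=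
  inferInstanceAs (Module k (cocycles μ p ⧸ (coboundaries μ p).submoduleOf (cocycles μ p)))

/-- The cohomology class of a cocycle. -/
def HH.mk (μ : Q.cochains 2) (p : ℤ) : cocycles μ p →ₗ[k] HH μ p := Submodule.mkQ _

/-- The projection `π₀` of a cochain to its part with no arguments. -/
def zeroPart (p : ℤ) : Q.cochains p →ₗ[k] ∀ A : Q.Ob, Q.gr A A p where
  toFun φ A := ⟨φ.1 A A (nil A), by simpa using φ.2.1 A A (nil A)⟩
  map_add' _ _ := rfl
  map_smul' _ _ := rfl

end GradedQuiver

open GradedQuiver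

section LinearCategory
variable (k : Type w) [CommRing k] (a : Type u) [Category.{v} a] [Preadditive a] [Linear k a]

/-- A `k`-linear category as a graded quiver concentrated in degree zero. -/
abbrev linQuiver : GradedQuiver.{w, v, u} k where
  Ob := a
  Hom X Y := X ⟶ Y
  gr _ _ d :=
    { carrier := {f | d ≠ 0 → f = 0}
      add_mem' := fun hf hg h => by rw [hf h, hg h, add_zero]
      zero_mem' := fun _ => rfl
      smul_mem' := fun r f hf h => by rw [hf h, smul_zero] }

/-- A precomplex in `a`: a graded object with an endomorphism of degree one. -/
structure Precomplex where
  X : ℤ → a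
  d : ∀ i j : ℤ, X i ⟶ X j
  shape : ∀ i j : ℤ, i + 1 ≠ j → d i j = 0

/-- The graded quiver of precomplexes in `a`, with the degree `n` part of `Hom(C, D)` being
`∏ p, a(C^p, D^{p+n})`. -/
abbrev precomplexQuiver : GradedQuiver.{w, v, max u v} k where
  Ob := Precomplex a
  Hom C D := ∀ i j : ℤ, C.X i ⟶ D.X j
  gr C D n :=
    { carrier := {f | ∀ i j : ℤ, i + n ≠ j → f i j = 0}
      add_mem' := fun hf hg i j h => by simp only [Pi.add_apply, hf i j h, hg i j h, add_zero]
      zero_mem' := fun _ _ _ => rfl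
      smul_mem' := fun r f hf i j h => by simp only [Pi.smul_apply, hf i j h, smul_zero] }

variable {k a}

/-- The morphism in a chain of length one, and zero on other chains. -/
def asMor : {X Y : (linQuiver k a).Ob} → (linQuiver k a).Chain X Y → (X ⟶ Y)
  | _, _, .cons _ f (.nil _) => f.1
  | _, _, .nil _ => 0
  | _, _, .cons _ _ (.cons _ _ _) => 0

/-- The composition of a chain of length two, and zero on other chains. -/
def asComp : {X Y : (linQuiver k a).Ob} → (linQuiver k a).Chain X Y → (X ⟶ Y)
  | _, _, .cons _ f c => f.1 ≫ asMor c
  | _, _, .nil _ => 0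

lemma asMor_mem {X Y : a} (c : (linQuiver k a).Chain X Y) (h : c.bdeg + 1 ≠ 0) : asMor c = 0 :=
  match c with
  | .cons d f (.nil _) => f.2 (by simpa using h)
  | .nil _ => rfl
  | .cons _ _ (.cons _ _ _) => rfl

lemma asComp_mem {X Y : a} (c : (linQuiver k a).Chain X Y) (h : c.bdeg + 2 ≠ 0) : asComp c = 0 :=
  match c with
  | .nil _ => rfl
  | .cons d f c => by
    by_cases hd : d = 0
    · have := asMor_mem c (fun he => h (by simp only [Chain.bdeg_cons, hd]; linarith))
      simp [asComp, this]
    · simp [asComp, f.2 hd]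

lemma asMor_linear {X Y Z W : a} (c : (linQuiver k a).Chain X Y) (d : ℤ)
    (c' : (linQuiver k a).Chain Z W) :
    IsLinearMap k fun f : (linQuiver k a).gr Y Z d => asMor (c.append (.cons d f c')) :=
  match c, c' with
  | .nil _, .nil _ => ⟨fun _ _ => rfl, fun _ _ => rfl⟩
  | .nil _, .cons _ _ _ => ⟨fun _ _ => (add_zero _).symm, fun _ _ => (smul_zero _).symm⟩
  | .cons _ _ (.nil _), _ => ⟨fun _ _ => (add_zero _).symm, fun _ _ => (smul_zero _).symm⟩
  | .cons _ _ (.cons _ _ _), _ => ⟨fun _ _ => (add_zero _).symm, fun _ _ => (smul_zero _).symm⟩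

lemma asComp_linear {X Y Z W : a} (c : (linQuiver k a).Chain X Y) (d : ℤ)
    (c' : (linQuiver k a).Chain Z W) :
    IsLinearMap k fun f : (linQuiver k a).gr Y Z d => asComp (c.append (.cons d f c')) :=
  match c with
  | .nil _ => ⟨fun f g => by simp [Chain.append, asComp],
      fun r f => by simp [Chain.append, asComp]⟩
  | .cons e g c => ⟨fun f h => by simp [Chain.append, asComp, (asMor_linear c d c').map_add],
      fun r f => by simp [Chain.append, asComp, (asMor_linear c d c').map_smul]⟩

variable (k a)

/-- The composition of `a` as a Hochschild cochain of degree two. -/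
def mult : (linQuiver k a).cochains 2 :=
  ⟨fun _ _ c => asComp c, fun _ _ c h => asComp_mem c h, fun _ _ _ _ c d c' => asComp_linear c d c'⟩

variable {k a}

/-- The index in the target reached by a chain of homogeneous maps of precomplexes from the index `p`
of the source. -/
def endIdx : {C D : (precomplexQuiver k a).Ob} → (precomplexQuiver k a).Chain C D → ℤ → ℤ
  | _, _, .nil _, p => p
  | _, _, .cons d _ c, p => endIdx c (p + d)

/-- The components of a chain of homogeneous maps of precomplexes along the indices from `p` on. -/
def path : {C D : (precomplexQuiver k a).Ob} → (c : (precomplexQuiver k a).Chain C D) → (p : ℤ) →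
    (linQuiver k a).Chain (C.X p) (D.X (endIdx c p))
  | C, _, .nil _, p => Chain.nil (Q := linQuiver k a) (C.X p)
  | _, _, .cons d f c, p => .cons 0 ⟨f.1 p (p + d), fun h => (h rfl).elim⟩ (path c (p + d))

lemma endIdx_eq {C D : (precomplexQuiver k a).Ob} (c : (precomplexQuiver k a).Chain C D) (p : ℤ) :
    endIdx c p = p + c.deg := by
  induction c generalizing p with
  | nil => simp [endIdx, Chain.deg]
  | cons d f c ih => simp [endIdx, Chain.deg, ih, add_assoc]

lemma bdeg_path {C D : (precomplexQuiver k a).Ob} (c : (precomplexQuiver k a).Chain C D) (p : ℤ) :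
    (path c p).bdeg = c.bdeg - c.deg := by
  induction c generalizing p with
  | nil C => exact (sub_self (0 : ℤ)).symm
  | cons d f c ih =>
    refine (Chain.bdeg_cons (Q := linQuiver k a) 0 _ (path c (p + d))).trans ?_
    rw [ih, Chain.bdeg_cons, Chain.deg]
    ring

/-- The values of `extend`. -/
def extendRaw {n : ℤ} (φ : (linQuiver k a).cochains n) : (precomplexQuiver k a).Raw :=
  fun _ D c p q => if h : endIdx c p = q then φ.1 _ _ (path c p) ≫ eqToHom (congrArg D.X h) else 0

lemma extendRaw_linear {n : ℤ} (φ : (linQuiver k a).cochains n) {C D E F : (precomplexQuiver k a).Ob}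
    (c : (precomplexQuiver k a).Chain C D) (d : ℤ) (c' : (precomplexQuiver k a).Chain E F)
    (p q : ℤ) (Y : a) (b : (linQuiver k a).Chain Y (C.X p)) :
    IsLinearMap k fun f : (precomplexQuiver k a).gr D E d =>
      (if h : endIdx (c.append (.cons d f c')) p = q then
        φ.1 _ _ (b.append (path (c.append (.cons d f c')) p)) ≫ eqToHom (congrArg F.X h)
      else 0 : Y ⟶ F.X q) := by
  induction c generalizing p Y with
  | nil C =>
    simp only [Chain.append, endIdx, path]
    by_cases h : endIdx c' (p + d) = q
    · simp only [h, ↓reduceDIte]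
      have h1 := φ.2.2 _ _ _ _ b 0 (path c' (p + d))
      exact ⟨fun f g => by
        rw [← Preadditive.add_comp, ← h1.map_add]; rfl, fun r f => by
        rw [← Linear.smul_comp, ← h1.map_smul]; rfl⟩
    · simp only [h, ↓reduceDIte]
      exact ⟨fun _ _ => (add_zero _).symm, fun _ _ => (smul_zero _).symm⟩
  | cons e g c ih =>
    have := ih (p + e) Y (b.append (.cons 0 ⟨g.1 p (p + e), fun h => (h rfl).elim⟩ (.nil _)))
    simpa only [Chain.append_assoc, Chain.append, endIdx, path] using this

/-- The canonical map `C(a) → C(PCom(a))`, applying a cochain componentwise. -/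
def extend (n : ℤ) : (linQuiver k a).cochains n →ₗ[k] (precomplexQuiver k a).cochains n where
  toFun φ := ⟨extendRaw φ, by
    refine ⟨fun C D c p q hpq => ?_, fun C D E F c d c' => ?_⟩
    · by_cases h : endIdx c p = q
      · have h0 : φ.1 _ _ (path c p) = 0 := φ.2.1 _ _ (path c p) (fun h' => hpq (by
          rw [bdeg_path] at h'
          rw [← h, endIdx_eq]
          linarith))
        simp [extendRaw, h0]
      · simp [extendRaw, h]
    · have := fun p q => extendRaw_linear φ c d c' p q _ (.nil _)
      exact ⟨fun f g => funext fun p => funext fun q => (this p q).map_add f g,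
        fun r f => funext fun p => funext fun q => (this p q).map_smul r f⟩⟩
  map_add' φ ψ := by
    ext C D c p q
    by_cases h : endIdx c p = q <;> simp [extendRaw, h]
  map_smul' r φ := by
    ext C D c p q
    by_cases h : endIdx c p = q <;> simp [extendRaw, h]

variable (k a)

/-- The element `δ` of degree one of `C(PCom(a))`: the predifferentials, with no arguments. -/
def differentialCochain : (precomplexQuiver k a).cochains 1 :=
  ⟨fun _ _ c => match c with
    | .nil C => C.d
    | .cons _ _ _ => 0, by
    refine ⟨fun C D c => ?_, fun C D E F c d c' => ?_⟩
    · match c with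
      | .nil C => exact fun i j h => C.shape i j (by simpa using h)
      | .cons _ _ _ => exact fun i j h => rfl
    · match c with
      | .nil C => exact ⟨fun _ _ => (add_zero _).symm, fun _ _ => (smul_zero _).symm⟩
      | .cons _ _ _ => exact ⟨fun _ _ => (add_zero _).symm, fun _ _ => (smul_zero _).symm⟩⟩

/-- The brace `φ{δ, …, δ}` with `m` entries `δ`, computed on bar cochains. -/
def braceDelta (n m : ℕ) (φ : (precomplexQuiver k a).cochains n) :
    (precomplexQuiver k a).cochains n :=
  susp n (brace (susp n φ) (List.replicate m ⟨1, susp 1 (differentialCochain k a)⟩) n (by simp))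

/-- The map `embr_δ : C(a) → C(PCom(a))`, `φ ↦ ∑ₘ φ{δ^{⊗ m}}`. A cochain of degree `n` on `a` has
`n` arguments, so that the terms with `m > n` vanish. -/
def embr (n : ℕ) : (linQuiver k a).cochains n →ₗ[k] (precomplexQuiver k a).cochains n where
  toFun φ := ∑ m ∈ Finset.range (n + 1), braceDelta k a n m (extend n φ)
  map_add' φ ψ := by
    simp only [map_add, braceDelta, brace_add, Finset.sum_add_distrib]
  map_smul' r φ := by
    simp only [map_smul, braceDelta, brace_smul, Finset.smul_sum, RingHom.id_apply]

open CochainComplex.HomComplex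

/-- The precomplex underlying a complex. -/
def toPrecomplex (C : CochainComplex a ℤ) : Precomplex a := ⟨C.X, C.d, fun i j h => C.shape i j h⟩

/-- The characteristic dg morphism (lifted characteristic morphism) in degree `n`: the component at the
complex `C` is the zero part at `C` of `embr_δ φ`. -/
def characteristicDg (n : ℕ) :
    (linQuiver k a).cochains n →ₗ[k] ∀ C : CochainComplex a ℤ, Cochain C C n where
  toFun φ C := Cochain.mk fun p q _ => (zeroPart _ (embr k a n φ) (toPrecomplex a C)).1 p q
  map_add' φ ψ := by
    ext C p q h
    simp only [map_add]
    rfl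
  map_smul' r φ := by
    ext C p q h
    simp only [map_smul, RingHom.id_apply]
    rfl

end LinearCategory

section LinearCategory
variable {k : Type w} [CommRing k] {a : Type u} [Category.{v} a] [Preadditive a] [Linear k a]

/-- The chain `X → Y`. -/
def chain₁ {X Y : a} (f : X ⟶ Y) : (linQuiver k a).Chain X Y :=
  .cons 0 ⟨f, fun h => (h rfl).elim⟩ (Chain.nil (Q := linQuiver k a) Y)

/-- The chain `X → Y → Z`. -/
def chain₂ {X Y Z : a} (f : X ⟶ Y) (g : Y ⟶ Z) : (linQuiver k a).Chain X Z :=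
  .cons 0 ⟨f, fun h => (h rfl).elim⟩ (chain₁ g)

/-- The chain `X → Y → Z → W`. -/
def chain₃ {X Y Z W : a} (f : X ⟶ Y) (g : Y ⟶ Z) (h : Z ⟶ W) : (linQuiver k a).Chain X W :=
  .cons 0 ⟨f, fun h => (h rfl).elim⟩ (chain₂ g h)

/-- The value `φ(g, f)` of a cochain on composable morphisms, the first morphism `f` being written first. -/
def app₂ (φ : (linQuiver k a).cochains 2) {X Y Z : a} (f : X ⟶ Y) (g : Y ⟶ Z) : X ⟶ Z :=
  φ.1 X Z (chain₂ f g)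

lemma cochain_zero {n : ℤ} (φ : (linQuiver k a).cochains n) {X Y Z W : a}
    (c : (linQuiver k a).Chain X Y) (d : ℤ) (hd : (0 : Y ⟶ Z) ∈ (linQuiver k a).gr Y Z d)
    (c' : (linQuiver k a).Chain Z W) :
    φ.1 _ _ (c.append (.cons d ⟨0, hd⟩ c')) = 0 :=
  (φ.2.2 _ _ _ _ c d c').map_zero

lemma app₂_left (φ : (linQuiver k a).cochains 2) {X Y Z : a} (f : X ⟶ Y) (g : Y ⟶ Z) (e : ℤ)
    (hf : f ∈ (linQuiver k a).gr X Y e) (hg : g ∈ (linQuiver k a).gr Y Z 0) (he : e = 0) :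
    φ.1 X Z (.cons e ⟨f, hf⟩ (.cons 0 ⟨g, hg⟩ (Chain.nil (Q := linQuiver k a) Z))) =
      app₂ φ f g := by
  subst he; rfl

lemma app₂_right (φ : (linQuiver k a).cochains 2) {X Y Z : a} (f : X ⟶ Y) (g : Y ⟶ Z) (e : ℤ)
    (hf : f ∈ (linQuiver k a).gr X Y 0) (hg : g ∈ (linQuiver k a).gr Y Z e) (he : e = 0) :
    φ.1 X Z (.cons 0 ⟨f, hf⟩ (.cons e ⟨g, hg⟩ (Chain.nil (Q := linQuiver k a) Z))) =
      app₂ φ f g := by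
  subst he; rfl

lemma differential_chain₃ (φ : (linQuiver k a).cochains 2) {X Y Z W : a}
    (f : X ⟶ Y) (g : Y ⟶ Z) (h : Z ⟶ W) :
    (differential (mult k a) 2 3 rfl φ).1 X W (chain₃ f g h) =
      f ≫ app₂ φ g h - app₂ φ (f ≫ g) h + app₂ φ f (g ≫ h) - app₂ φ f g ≫ h := by
  have z0 := fun {X Y Z : a} (d : ℤ) (hd : (0 : X ⟶ Y) ∈ (linQuiver k a).gr X Y d)
    (c' : (linQuiver k a).Chain Y Z) => cochain_zero φ (Chain.nil (Q := linQuiver k a) X) d hd c'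
  have z1 := fun {X Y Z W : a} (e : ℤ) (x : (linQuiver k a).gr X Y e) (d : ℤ)
    (hd : (0 : Y ⟶ Z) ∈ (linQuiver k a).gr Y Z d)
    (c' : (linQuiver k a).Chain Z W) =>
    cochain_zero φ (.cons e x (Chain.nil (Q := linQuiver k a) Y)) d hd c'
  have z2 := fun {X X' Y Z W : a} (e : ℤ) (x : (linQuiver k a).gr X X' e)
    (e' : ℤ) (x' : (linQuiver k a).gr X' Y e') (d : ℤ)
    (hd : (0 : Y ⟶ Z) ∈ (linQuiver k a).gr Y Z d)
    (c' : (linQuiver k a).Chain Z W) =>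
    cochain_zero φ (.cons e x (.cons e' x' (Chain.nil (Q := linQuiver k a) Y))) d hd c'
  have z3 := fun {X X' X'' Y Z W : a} (e : ℤ) (x : (linQuiver k a).gr X X' e)
    (e' : ℤ) (x' : (linQuiver k a).gr X' X'' e') (e'' : ℤ) (x'' : (linQuiver k a).gr X'' Y e'')
    (d : ℤ) (hd : (0 : Y ⟶ Z) ∈ (linQuiver k a).gr Y Z d)
    (c' : (linQuiver k a).Chain Z W) =>
    cochain_zero φ (.cons e x (.cons e' x' (.cons e'' x'' (Chain.nil (Q := linQuiver k a) Y))))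
      d hd c'
  simp only [Chain.append] at z0 z1 z2 z3
  simp [differential, susp, bracket, brace, braceRaw, insertions, chain₃, chain₂, chain₁,
    Chain.splits, suspSign, Chain.append, Chain.length, Chain.weight, Chain.deg, mult, asComp,
    asMor, z0, z1, z2, z3]
  rw [app₂_left _ f g _ _ _ (by rfl), app₂_left _ g h _ _ _ (by rfl),
    app₂_left _ (f ≫ g) h _ _ _ (by rfl), app₂_right _ f (g ≫ h) _ _ _ (by rfl)]
  abel

/-- The value of a cochain of degree one on a morphism. -/
def app₁ (ψ : (linQuiver k a).cochains 1) {X Y : a} (f : X ⟶ Y) : X ⟶ Y :=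
  ψ.1 X Y (chain₁ f)

lemma app₁_eq (φ : (linQuiver k a).cochains 1) {X Y : a} (f : X ⟶ Y) (e : ℤ)
    (hf : f ∈ (linQuiver k a).gr X Y e) (he : e = 0) :
    φ.1 X Y (.cons e ⟨f, hf⟩ (Chain.nil (Q := linQuiver k a) Y)) = app₁ φ f := by
  subst he; rfl

lemma differential_chain₂ (ψ : (linQuiver k a).cochains 1) {X Y Z : a}
    (f : X ⟶ Y) (g : Y ⟶ Z) :
    app₂ (differential (mult k a) 1 2 rfl ψ) f g =
      f ≫ app₁ ψ g - app₁ ψ (f ≫ g) + app₁ ψ f ≫ g := by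
  have z0 := fun {X Y Z : a} (d : ℤ) (hd : (0 : X ⟶ Y) ∈ (linQuiver k a).gr X Y d)
    (c' : (linQuiver k a).Chain Y Z) => cochain_zero ψ (Chain.nil (Q := linQuiver k a) X) d hd c'
  have z1 := fun {X Y Z W : a} (e : ℤ) (x : (linQuiver k a).gr X Y e) (d : ℤ)
    (hd : (0 : Y ⟶ Z) ∈ (linQuiver k a).gr Y Z d)
    (c' : (linQuiver k a).Chain Z W) =>
    cochain_zero ψ (.cons e x (Chain.nil (Q := linQuiver k a) Y)) d hd c'
  have z2 := fun {X X' Y Z W : a} (e : ℤ) (x : (linQuiver k a).gr X X' e)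
    (e' : ℤ) (x' : (linQuiver k a).gr X' Y e') (d : ℤ)
    (hd : (0 : Y ⟶ Z) ∈ (linQuiver k a).gr Y Z d)
    (c' : (linQuiver k a).Chain Z W) =>
    cochain_zero ψ (.cons e x (.cons e' x' (Chain.nil (Q := linQuiver k a) Y))) d hd c'
  simp only [Chain.append] at z0 z1 z2
  simp [differential, susp, bracket, brace, braceRaw, insertions, app₂, chain₂, chain₁,
    Chain.splits, suspSign, Chain.append, Chain.length, Chain.weight, Chain.deg, mult, asComp,
    asMor, z0, z1, z2]
  rw [app₁_eq _ f _ _ (by rfl), app₁_eq _ g _ _ (by rfl), app₁_eq _ (f ≫ g) _ _ (by rfl)]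
  abel

lemma characteristicDg_two (φ : (linQuiver k a).cochains 2) (C : CochainComplex a ℤ) (p q : ℤ)
    (h : p + 2 = q) :
    (characteristicDg k a 2 φ C).v p q h = -app₂ φ (C.d p (p + 1)) (C.d (p + 1) q) := by
  subst h
  change (embr k a 2 φ).1 _ _ _ p (p + 2) = _
  simp [embr, braceDelta, Finset.sum_range_succ, susp, brace, braceRaw, insertions, Chain.splits,
    suspSign, Chain.append, Chain.length, Chain.weight, Chain.deg, extend, extendRaw, endIdx, path]
  have key : ∀ (q : ℤ) (h : p + 1 + 1 = q),
      app₂ φ (C.d p (p + 1)) (C.d (p + 1) (p + 1 + 1)) ≫ eqToHom (congrArg C.X h) =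
        app₂ φ (C.d p (p + 1)) (C.d (p + 1) q) := by
    rintro _ rfl
    simp
  exact congrArg Neg.neg ((dif_pos (by ring)).trans (key _ (by ring)))

lemma app₂_add_left (φ : (linQuiver k a).cochains 2) {X Y Z : a} (f f' : X ⟶ Y) (g : Y ⟶ Z) :
    app₂ φ (f + f') g = app₂ φ f g + app₂ φ f' g :=
  (φ.2.2 _ _ _ _ (Chain.nil (Q := linQuiver k a) X) 0 (chain₁ g)).map_add
    ⟨f, fun h => (h rfl).elim⟩ ⟨f', fun h => (h rfl).elim⟩

lemma app₂_smul_left (φ : (linQuiver k a).cochains 2) {X Y Z : a} (r : k) (f : X ⟶ Y) (g : Y ⟶ Z) :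
    app₂ φ (r • f) g = r • app₂ φ f g :=
  (φ.2.2 _ _ _ _ (Chain.nil (Q := linQuiver k a) X) 0 (chain₁ g)).map_smul r
    ⟨f, fun h => (h rfl).elim⟩

lemma app₂_add_right (φ : (linQuiver k a).cochains 2) {X Y Z : a} (f : X ⟶ Y) (g g' : Y ⟶ Z) :
    app₂ φ f (g + g') = app₂ φ f g + app₂ φ f g' :=
  (φ.2.2 _ _ _ _ (chain₁ f) 0 (Chain.nil (Q := linQuiver k a) Z)).map_add
    ⟨g, fun h => (h rfl).elim⟩ ⟨g', fun h => (h rfl).elim⟩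

lemma app₂_smul_right (φ : (linQuiver k a).cochains 2) {X Y Z : a} (r : k) (f : X ⟶ Y)
    (g : Y ⟶ Z) : app₂ φ f (r • g) = r • app₂ φ f g :=
  (φ.2.2 _ _ _ _ (chain₁ f) 0 (Chain.nil (Q := linQuiver k a) Z)).map_smul r
    ⟨g, fun h => (h rfl).elim⟩

/-- `app₂` as a bilinear map. -/
def app₂Hom (φ : (linQuiver k a).cochains 2) (X Y Z : a) : (X ⟶ Y) →ₗ[k] (Y ⟶ Z) →ₗ[k] (X ⟶ Z) :=
  LinearMap.mk₂ k (app₂ φ) (app₂_add_left φ) (app₂_smul_left φ) (app₂_add_right φ)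
    (app₂_smul_right φ)

@[simp] lemma app₂_zero_left (φ : (linQuiver k a).cochains 2) {X Y Z : a} (g : Y ⟶ Z) :
    app₂ φ (0 : X ⟶ Y) g = 0 := LinearMap.map_zero₂ (app₂Hom φ X Y Z) g

@[simp] lemma app₂_zero_right (φ : (linQuiver k a).cochains 2) {X Y Z : a} (f : X ⟶ Y) :
    app₂ φ f (0 : Y ⟶ Z) = 0 := (app₂Hom φ X Y Z f).map_zero

lemma app₂_cocycle (φ : cocycles (mult k a) 2) {X Y Z W : a} (f : X ⟶ Y) (g : Y ⟶ Z)
    (h : Z ⟶ W) :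
    f ≫ app₂ φ.1 g h + app₂ φ.1 f (g ≫ h) = app₂ φ.1 (f ≫ g) h + app₂ φ.1 f g ≫ h := by
  have h1 := differential_chain₃ φ.1 f g h
  have h2 : differential (mult k a) 2 3 rfl φ.1 = 0 := φ.2
  rw [h2] at h1
  change 0 = _ at h1
  rw [← sub_eq_zero, h1]
  abel

end LinearCategory

section Deformation

variable {k : Type w} [CommRing k] {a : Type u} [Category.{v} a] [Preadditive a] [Linear k a]

/-- The first order deformation `a_φ[ε]` of `a` defined by a Hochschild cocycle `φ` of degree two. Its
objects are those of `a`, its morphisms are `a[ε]`, and its composition is `m + φ ε`. -/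
structure Deformation (φ : cocycles (mult k a) 2) where
  of : a

namespace Deformation

variable {φ : cocycles (mult k a) 2}

/-- Morphisms `f₀ + f₁ ε` of the deformation. -/
structure Hom (X Y : Deformation φ) where
  coeff₀ : X.of ⟶ Y.of
  coeff₁ : X.of ⟶ Y.of

lemma app₂_id_left {X Y : a} (f : X ⟶ Y) : app₂ φ.1 (𝟙 X) f = app₂ φ.1 (𝟙 X) (𝟙 X) ≫ f := by
  have := app₂_cocycle φ (𝟙 X) (𝟙 X) f
  simp only [Category.id_comp] at this
  rw [add_comm] at this
  exact add_left_cancel this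

lemma app₂_id_right {X Y : a} (f : X ⟶ Y) : app₂ φ.1 f (𝟙 Y) = f ≫ app₂ φ.1 (𝟙 Y) (𝟙 Y) := by
  have := app₂_cocycle φ f (𝟙 Y) (𝟙 Y)
  simp only [Category.comp_id] at this
  rw [add_comm] at this
  exact (add_left_cancel this).symm

instance : Category (Deformation φ) where
  Hom := Hom
  id X := ⟨𝟙 X.of, -app₂ φ.1 (𝟙 X.of) (𝟙 X.of)⟩
  comp f g := ⟨f.coeff₀ ≫ g.coeff₀,
    f.coeff₀ ≫ g.coeff₁ + f.coeff₁ ≫ g.coeff₀ + app₂ φ.1 f.coeff₀ g.coeff₀⟩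
  id_comp f := by
    simp [app₂_id_left f.coeff₀]
  comp_id f := by
    simp [app₂_id_right f.coeff₀]
  assoc f g h := by
    simp only [Category.assoc, Hom.mk.injEq, true_and, Preadditive.comp_add, Preadditive.add_comp]
    have := app₂_cocycle φ f.coeff₀ g.coeff₀ h.coeff₀
    rw [← sub_eq_zero] at this ⊢
    rw [← neg_eq_zero, ← this]
    abel

@[ext] lemma hom_ext {X Y : Deformation φ} {f g : X ⟶ Y} (h₀ : f.coeff₀ = g.coeff₀)
    (h₁ : f.coeff₁ = g.coeff₁) : f = g := by
  change Hom X Y at f g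
  cases f; cases g; cases h₀; cases h₁; rfl

@[simp] lemma id_coeff₀ (X : Deformation φ) : (𝟙 X : X ⟶ X).coeff₀ = 𝟙 X.of := rfl
@[simp] lemma id_coeff₁ (X : Deformation φ) :
    (𝟙 X : X ⟶ X).coeff₁ = -app₂ φ.1 (𝟙 X.of) (𝟙 X.of) := rfl
@[simp] lemma comp_coeff₀ {X Y Z : Deformation φ} (f : X ⟶ Y) (g : Y ⟶ Z) :
    (f ≫ g).coeff₀ = f.coeff₀ ≫ g.coeff₀ := rfl
@[simp] lemma comp_coeff₁ {X Y Z : Deformation φ} (f : X ⟶ Y) (g : Y ⟶ Z) :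
    (f ≫ g).coeff₁ = f.coeff₀ ≫ g.coeff₁ + f.coeff₁ ≫ g.coeff₀ + app₂ φ.1 f.coeff₀ g.coeff₀ := rfl

instance (X Y : Deformation φ) : Zero (X ⟶ Y) := ⟨⟨0, 0⟩⟩

instance (X Y : Deformation φ) : Add (X ⟶ Y) :=
  ⟨fun f g => ⟨f.coeff₀ + g.coeff₀, f.coeff₁ + g.coeff₁⟩⟩

instance (X Y : Deformation φ) : Neg (X ⟶ Y) := ⟨fun f => ⟨-f.coeff₀, -f.coeff₁⟩⟩

instance (X Y : Deformation φ) : AddCommGroup (X ⟶ Y) where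
  add_assoc _ _ _ := hom_ext (add_assoc _ _ _) (add_assoc _ _ _)
  zero_add _ := hom_ext (zero_add _) (zero_add _)
  add_zero _ := hom_ext (add_zero _) (add_zero _)
  neg_add_cancel _ := hom_ext (neg_add_cancel _) (neg_add_cancel _)
  add_comm _ _ := hom_ext (add_comm _ _) (add_comm _ _)
  nsmul := nsmulRec
  zsmul := zsmulRec

@[simp] lemma add_coeff₀ {X Y : Deformation φ} (f g : X ⟶ Y) :
    (f + g).coeff₀ = f.coeff₀ + g.coeff₀ := rfl
@[simp] lemma add_coeff₁ {X Y : Deformation φ} (f g : X ⟶ Y) :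
    (f + g).coeff₁ = f.coeff₁ + g.coeff₁ := rfl
@[simp] lemma zero_coeff₀ (X Y : Deformation φ) : (0 : X ⟶ Y).coeff₀ = 0 := rfl
@[simp] lemma zero_coeff₁ (X Y : Deformation φ) : (0 : X ⟶ Y).coeff₁ = 0 := rfl
@[simp] lemma neg_coeff₀ {X Y : Deformation φ} (f : X ⟶ Y) : (-f).coeff₀ = -f.coeff₀ := rfl
@[simp] lemma neg_coeff₁ {X Y : Deformation φ} (f : X ⟶ Y) : (-f).coeff₁ = -f.coeff₁ := rfl

instance : Preadditive (Deformation φ) where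
  add_comp _ _ _ f f' g := by
    ext <;> simp [app₂_add_left]
    abel
  comp_add _ _ _ f g g' := by
    ext <;> simp [app₂_add_right]
    abel

instance (X Y : Deformation φ) : Module (DualNumber k) (X ⟶ Y) where
  smul r f := ⟨r.fst • f.coeff₀, r.fst • f.coeff₁ + r.snd • f.coeff₀⟩
  one_smul f := hom_ext (one_smul _ _) (by
    change (1 : k) • _ + (0 : k) • _ = _
    rw [one_smul, zero_smul, add_zero])
  mul_smul r s f := hom_ext (mul_smul r.fst s.fst f.coeff₀) (by
    change (r.fst * s.fst) • f.coeff₁ + (r * s).snd • f.coeff₀ =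
      r.fst • (s.fst • f.coeff₁ + s.snd • f.coeff₀) + r.snd • s.fst • f.coeff₀
    rw [DualNumber.snd_mul]
    module)
  smul_zero r := hom_ext (smul_zero _) (by
    change r.fst • (0 : X.of ⟶ Y.of) + r.snd • (0 : X.of ⟶ Y.of) = 0
    simp)
  smul_add r f g := hom_ext (smul_add _ _ _) (by
    change r.fst • (f.coeff₁ + g.coeff₁) + r.snd • (f.coeff₀ + g.coeff₀) =
      (r.fst • f.coeff₁ + r.snd • f.coeff₀) + (r.fst • g.coeff₁ + r.snd • g.coeff₀)
    module)
  add_smul r s f := hom_ext (add_smul r.fst s.fst f.coeff₀) (by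
    change (r.fst + s.fst) • f.coeff₁ + (r.snd + s.snd) • f.coeff₀ =
      (r.fst • f.coeff₁ + r.snd • f.coeff₀) + (s.fst • f.coeff₁ + s.snd • f.coeff₀)
    module)
  zero_smul f := hom_ext (zero_smul k _) (by
    change (0 : k) • _ + (0 : k) • _ = _
    simp)

@[simp] lemma smul_coeff₀ {X Y : Deformation φ} (r : DualNumber k) (f : X ⟶ Y) :
    (r • f).coeff₀ = r.fst • f.coeff₀ := rfl
@[simp] lemma smul_coeff₁ {X Y : Deformation φ} (r : DualNumber k) (f : X ⟶ Y) :
    (r • f).coeff₁ = r.fst • f.coeff₁ + r.snd • f.coeff₀ := rfl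

instance : Linear (DualNumber k) (Deformation φ) where
  smul_comp _ _ _ r f g := by
    ext <;> simp [app₂_smul_left]
    abel
  comp_smul _ _ _ f r g := by
    ext <;> simp [app₂_smul_right]
    abel

variable (φ)

/-- The reduction `k ⊗_{k[ε]} a_φ[ε] → a` modulo `ε`. -/
def reduction : Deformation φ ⥤ a where
  obj X := X.of
  map f := f.coeff₀

instance : (reduction φ).Additive where

end Deformation

/-- A lift of the differential of a complex `C` to a predifferential over `a_φ[ε]` on the same graded
object, not required to square to zero. -/
structure GradedLift (φ : cocycles (mult k a) 2) (C : CochainComplex a ℤ) where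
  d : ∀ i j : ℤ, (⟨C.X i⟩ : Deformation φ) ⟶ ⟨C.X j⟩
  shape : ∀ i j : ℤ, i + 1 ≠ j → d i j = 0
  reduction_d : ∀ i j : ℤ, (Deformation.reduction φ).map (d i j) = C.d i j

open CochainComplex.HomComplex

namespace GradedLift
variable {φ : cocycles (mult k a) 2} {C : CochainComplex a ℤ}

/-- The curvature `-(d ∘ d)` of a graded lift. -/
def curvature (L : GradedLift φ C) (p q : ℤ) : (⟨C.X p⟩ : Deformation φ) ⟶ ⟨C.X q⟩ :=
  -(L.d p (p + 1) ≫ L.d (p + 1) q)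

lemma reduction_curvature (L : GradedLift φ C) (p q : ℤ) :
    (Deformation.reduction φ).map (L.curvature p q) = 0 := by
  rw [curvature, Functor.map_neg, Functor.map_comp, L.reduction_d, L.reduction_d]
  exact neg_eq_zero.2 (C.d_comp_d p (p + 1) q)

/-- The curvature of a graded lift is `u ε` for a cocycle `u` of degree two in the complex of
endomorphisms of `C`. -/
def cocycle (L : GradedLift φ C) : Cocycle C C 2 :=
  Cocycle.mk (Cochain.mk fun p q _ => (L.curvature p q).coeff₁) 3 (by norm_num) (by
    ext p q h
    have hD : ∀ i j, (L.d i j).coeff₀ = C.d i j := L.reduction_d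
    have hE : ∀ i j l, (L.d i j ≫ L.d j l).coeff₀ = 0 := fun i j l => by
      rw [Deformation.comp_coeff₀, hD, hD]
      exact C.d_comp_d i j l
    have key : (L.d p (p + 1) ≫ L.d (p + 1) (p + 1 + 1)).coeff₁ ≫ C.d (p + 1 + 1) q =
        C.d p (p + 1) ≫ (L.d (p + 1) (p + 1 + 1) ≫ L.d (p + 1 + 1) q).coeff₁ := by
      have h₁ := Deformation.comp_coeff₁ (L.d p (p + 1) ≫ L.d (p + 1) (p + 1 + 1))
        (L.d (p + 1 + 1) q)
      have h₂ := Deformation.comp_coeff₁ (L.d p (p + 1))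
        (L.d (p + 1) (p + 1 + 1) ≫ L.d (p + 1 + 1) q)
      rw [hE, hD] at h₁ h₂
      rw [Category.assoc, h₂] at h₁
      simpa using h₁.symm
    rw [δ_v 2 3 (by norm_num) _ p q h (p + 1 + 1) (p + 1) (by omega) rfl]
    simp only [Cochain.mk_v, curvature, Deformation.neg_coeff₁, Preadditive.neg_comp,
      Preadditive.comp_neg, key, Int.negOnePow_odd 3 (by decide), Cochain.zero_v, Units.neg_smul, one_smul]
    abel)

end GradedLift

end Deformation

section Centre
variable (k : Type w) [CommRing k] (T : Type u) [Category.{v} T] [Preadditive T] [Linear k T]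
  [HasShift T ℤ] [∀ n : ℤ, (shiftFunctor T n).Additive] [∀ n : ℤ, (shiftFunctor T n).Linear k]

/-- The degree `n` part of the graded centre of a `k`-linear category with shift: families
`ζ_X : X → X[n]` with `ζ_Y f = (-1)^{|f| n} f ζ_X` for all `f : X → Y[m]`, `|f| = m`. -/
def gradedCentre (n : ℤ) : Submodule k (∀ X : T, ShiftedHom X X n) where
  carrier := {ζ | ∀ (m : ℤ) (X Y : T) (f : ShiftedHom X Y m),
    f.comp (ζ Y) (add_comm n m) = (m * n).negOnePow • (ζ X).comp f rfl}
  add_mem' hζ hξ m X Y f := by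
    simp only [Pi.add_apply, ShiftedHom.comp_add, ShiftedHom.add_comp, hζ m X Y f, hξ m X Y f,
      smul_add]
  zero_mem' m X Y f := by simp
  smul_mem' r ζ hζ m X Y f := by
    simp only [Pi.smul_apply, ShiftedHom.comp_smul, ShiftedHom.smul_comp, hζ m X Y f,
      Units.smul_def]
    rw [smul_comm]

end Centre

section Characteristic

variable (k : Type w) [CommRing k] {a : Type u} [Category.{v} a] [Preadditive a] [Linear k a]

open CochainComplex.HomComplex

lemma equivHomShift_symm_f {K L : CochainComplex a ℤ} {n : ℤ} (z : Cocycle K L n) (p : ℤ) :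
    (Cocycle.equivHomShift.symm z).f p = z.1.v p (p + n) rfl :=
  (Cochain.rightShift_v z.1 n 0 (zero_add n) p p (by simp) _ rfl).trans
    (Category.comp_id _)

lemma v_comp_XIsoOfEq {K L : CochainComplex a ℤ} {n : ℤ} (z : Cochain K L n) (p q q' : ℤ)
    (h : p + n = q) (h' : q = q') :
    z.v p q h ≫ (L.XIsoOfEq h').hom = z.v p q' (h.trans h') := by
  subst h'
  simp

/-- The morphism `K → L[n]` in the homotopy category defined by a cocycle of degree `n`. -/
def homClass (K L : CochainComplex a ℤ) (n : ℤ) :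
    Cocycle K L n →ₗ[k] ShiftedHom ((HomotopyCategory.quotient a (.up ℤ)).obj K)
      ((HomotopyCategory.quotient a (.up ℤ)).obj L) n where
  toFun z := ShiftedHom.map (Cocycle.equivHomShift.symm z) (HomotopyCategory.quotient a (.up ℤ))
  map_add' z w := by rw [map_add]; exact ShiftedHom.map_add _ _ _
  map_smul' r z := by
    rw [RingHom.id_apply, ← ShiftedHom.map_smul]
    congr 1
    ext p
    change (Cocycle.equivHomShift.symm (r • z)).f p = r • (Cocycle.equivHomShift.symm z).f p
    rw [equivHomShift_symm_f, equivHomShift_symm_f]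
    rfl

variable {k}

lemma homClass_surjective (K L : CochainComplex a ℤ) (n : ℤ) :
    Function.Surjective (homClass k K L n) := fun f => by
  obtain ⟨g, hg⟩ := (HomotopyCategory.quotient a (.up ℤ)).map_surjective
    (f ≫ ((HomotopyCategory.quotient a (.up ℤ)).commShiftIso n).inv.app L)
  refine ⟨Cocycle.equivHomShift g, ?_⟩
  change ShiftedHom.map (Cocycle.equivHomShift.symm _) _ = f
  rw [AddEquiv.symm_apply_apply, ShiftedHom.map, hg]
  simp

lemma homClass_eq_zero (K L : CochainComplex a ℤ) (n m : ℤ) (hm : m + 1 = n) (z : Cocycle K L n)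
    (β : Cochain K L m) (h : δ m n β = z) : homClass k K L n z = 0 := by
  have := (CohomologyClass.toHom_mk_eq_zero_iff z).2 ((mem_coboundaries_iff z m hm).2 ⟨β, h⟩)
  rw [CohomologyClass.toHom_mk] at this
  change (HomotopyCategory.quotient a (.up ℤ)).map (Cocycle.equivHomShift.symm z) ≫ _ = 0
  rw [this, Limits.zero_comp]

lemma homClass_comp (K L M : CochainComplex a ℤ) (n m l : ℤ) (h : n + m = l) (z : Cocycle K L n)
    (w : Cocycle L M m) (y : Cocycle K M l) (hy : (y : Cochain K M l) = (z : Cochain K L n).comp w h) :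
    (homClass k K L n z).comp (homClass k L M m w) (by omega) = homClass k K M l y := by
  have : (ShiftedHom.comp (Cocycle.equivHomShift.symm z : ShiftedHom K L n)
      (Cocycle.equivHomShift.symm w : ShiftedHom L M m) (by omega)) =
      (Cocycle.equivHomShift.symm y : ShiftedHom K M l) := by
    ext p
    rw [equivHomShift_symm_f, hy, Cochain.comp_v _ _ h p (p + n) (p + l) rfl (by omega)]
    dsimp [ShiftedHom.comp]
    erw [equivHomShift_symm_f, equivHomShift_symm_f, CochainComplex.shiftFunctorAdd'_inv_app_f',
      v_comp_XIsoOfEq]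
  have e := congrArg (fun x => ShiftedHom.map x (HomotopyCategory.quotient a (.up ℤ))) this
  exact (ShiftedHom.map_comp _ _ _ _).symm.trans e

/-- The graded lift `d + 0 ε`. -/
def GradedLift.trivial (φ : cocycles (mult k a) 2) (C : CochainComplex a ℤ) : GradedLift φ C where
  d i j := ⟨C.d i j, 0⟩
  shape i j h := Deformation.hom_ext (C.shape i j h) rfl
  reduction_d _ _ := rfl

lemma characteristicDg_eq_cocycle (φ : cocycles (mult k a) 2) (C : CochainComplex a ℤ) :
    characteristicDg k a 2 φ.1 C = ((GradedLift.trivial φ C).cocycle : Cochain C C 2) := by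
  ext p q h
  rw [characteristicDg_two]
  simp [GradedLift.cocycle, GradedLift.curvature, GradedLift.trivial]

/-- The image of a Hochschild cocycle under the characteristic dg morphism is a cocycle. -/
def charCocycle (φ : cocycles (mult k a) 2) (C : CochainComplex a ℤ) : Cocycle C C 2 :=
  Cocycle.mk (characteristicDg k a 2 φ.1 C) 3 (by norm_num) (by
    rw [characteristicDg_eq_cocycle]
    exact Cocycle.δ_eq_zero _ _)

lemma charCocycle_v (φ : cocycles (mult k a) 2) (C : CochainComplex a ℤ) (p q r : ℤ)
    (hq : p + 1 = q) (h : p + 2 = r) :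
    (charCocycle φ C : Cochain C C 2).v p r h = -app₂ φ.1 (C.d p q) (C.d q r) := by
  subst hq
  exact characteristicDg_two φ.1 C p r h

/-- The composition of cocycles. -/
def compCocycle {K L M : CochainComplex a ℤ} {n m : ℤ} (l : ℤ) (h : n + m = l) (z : Cocycle K L n)
    (w : Cocycle L M m) : Cocycle K M l :=
  Cocycle.mk ((z : Cochain K L n).comp w h) (l + 1) rfl (by
    rw [δ_comp _ _ h (n + 1) (m + 1) (l + 1) rfl rfl rfl]
    simp)

lemma app₂_neg_left (φ : (linQuiver k a).cochains 2) {X Y Z : a} (f : X ⟶ Y) (g : Y ⟶ Z) :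
    app₂ φ (-f) g = -app₂ φ f g := LinearMap.map_neg₂ (app₂Hom φ X Y Z) f g

lemma app₂_neg_right (φ : (linQuiver k a).cochains 2) {X Y Z : a} (f : X ⟶ Y) (g : Y ⟶ Z) :
    app₂ φ f (-g) = -app₂ φ f g := (app₂Hom φ X Y Z f).map_neg g

lemma homotopy_identity (φ : cocycles (mult k a) 2) {X X' X'' Y Y' Y'' : a}
    (d₁ : X ⟶ X') (d₂ : X' ⟶ X'') (e₁ : Y ⟶ Y') (e₂ : Y' ⟶ Y'') (f : X ⟶ Y) (f' : X' ⟶ Y')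
    (f'' : X'' ⟶ Y'') (s : ℤˣ) (hd : d₁ ≫ d₂ = 0) (he : e₁ ≫ e₂ = 0)
    (h : f ≫ e₁ = s • d₁ ≫ f') (h' : f' ≫ e₂ = s • d₂ ≫ f'') :
    (app₂ φ.1 f e₁ - s • app₂ φ.1 d₁ f') ≫ e₂ +
      s • d₁ ≫ (app₂ φ.1 f' e₂ - s • app₂ φ.1 d₂ f'') =
      f ≫ app₂ φ.1 e₁ e₂ - app₂ φ.1 d₁ d₂ ≫ f'' := by
  have h₁ := app₂_cocycle φ f e₁ e₂
  have h₂ := app₂_cocycle φ d₁ f' e₂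
  have h₃ := app₂_cocycle φ d₁ d₂ f''
  rw [he, app₂_zero_right, add_zero] at h₁
  rw [hd, app₂_zero_left, zero_add] at h₃
  rw [← h₃, h₁]
  rw [h, h'] at *
  rw [← sub_eq_zero] at h₂
  rcases Int.units_eq_one_or s with rfl | rfl
  · simp only [one_smul, Preadditive.sub_comp, Preadditive.comp_sub] at h₂ ⊢
    rw [← sub_eq_zero, ← h₂]
    abel
  · simp only [Units.neg_smul, one_smul, Preadditive.sub_comp, Preadditive.comp_sub,
      Preadditive.comp_neg, Preadditive.neg_comp, app₂_neg_left, app₂_neg_right] at h₂ ⊢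
    rw [← sub_eq_zero, ← neg_eq_zero, ← h₂]
    abel

lemma charCocycle_comm (φ : cocycles (mult k a) 2) (C D : CochainComplex a ℤ) (m : ℤ)
    (f : Cocycle C D m) :
    (homClass k C D m f).comp (homClass k D D 2 (charCocycle φ D)) (add_comm 2 m) =
      (m * 2).negOnePow • (homClass k C C 2 (charCocycle φ C)).comp (homClass k C D m f) rfl := by
  have hs : (m * 2).negOnePow = 1 := Int.negOnePow_even _ ⟨m, by ring⟩
  rw [hs, one_smul, homClass_comp C D D m 2 (m + 2) rfl f (charCocycle φ D)
      (compCocycle (m + 2) rfl f (charCocycle φ D)) rfl,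
    homClass_comp C C D 2 m (m + 2) (add_comm _ _) (charCocycle φ C) f
      (compCocycle (m + 2) (add_comm _ _) (charCocycle φ C) f) rfl, ← sub_eq_zero, ← map_sub]
  let H : Cochain C D (m + 1) := Cochain.mk fun p q _ =>
    app₂ φ.1 (f.1.v p (p + m) rfl) (D.d (p + m) q) -
      m.negOnePow • app₂ φ.1 (C.d p (p + 1)) (f.1.v (p + 1) q (by omega))
  have hf : ∀ p q p' q' (h : p + m = q) (h' : p' + m = q') (hp : p + 1 = p'),
      f.1.v p q h ≫ D.d q q' = m.negOnePow • C.d p p' ≫ f.1.v p' q' h' := by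
    intro p q p' q' h h' hp
    have := congrArg (fun z => z.v p q' (by omega : p + (m + 1) = q'))
      (Cocycle.δ_eq_zero f (m + 1))
    simp only [δ_v m (m + 1) rfl f.1 p q' (by omega) q p' (by omega) hp, Cochain.zero_v,
      Int.negOnePow_succ, Units.neg_smul] at this
    rwa [← sub_eq_add_neg, sub_eq_zero] at this
  refine homClass_eq_zero C D (m + 2) (m + 1) (by ring) _ (-H) ?_
  rw [δ_neg]
  ext p q h
  rw [Cochain.neg_v, δ_v (m + 1) (m + 2) (by ring) H p q h (p + (m + 1)) (p + 1) (by omega) rfl]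
  change _ = ((f : Cochain C D m).comp (charCocycle φ D : Cochain D D 2) rfl).v p q h -
    ((charCocycle φ C : Cochain C C 2).comp (f : Cochain C D m) (add_comm _ _)).v p q h
  rw [Cochain.comp_v _ _ rfl p (p + m) q rfl (by omega),
    Cochain.comp_v _ _ (add_comm 2 m) p (p + 1 + 1) q (by omega) (by omega),
    charCocycle_v φ D (p + m) (p + (m + 1)) q (by omega) (by omega),
    charCocycle_v φ C p (p + 1) (p + 1 + 1) rfl (by omega)]
  have key := homotopy_identity φ (C.d p (p + 1)) (C.d (p + 1) (p + 1 + 1))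
    (D.d (p + m) (p + (m + 1))) (D.d (p + (m + 1)) q) (f.1.v p (p + m) rfl)
    (f.1.v (p + 1) (p + (m + 1)) (by omega)) (f.1.v (p + 1 + 1) q (by omega)) m.negOnePow
    (C.d_comp_d _ _ _) (D.d_comp_d _ _ _) (hf _ _ _ _ _ _ (by omega)) (hf _ _ _ _ _ _ (by omega))
  have hm : (m + 2).negOnePow = m.negOnePow := by
    rw [Int.negOnePow_add, Int.negOnePow_even 2 ⟨1, rfl⟩, mul_one]
  have hH : H.v (p + 1) q (by omega) = app₂ φ.1 (f.1.v (p + 1) (p + (m + 1)) (by omega))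
      (D.d (p + (m + 1)) q) - m.negOnePow • app₂ φ.1 (C.d (p + 1) (p + 1 + 1))
        (f.1.v (p + 1 + 1) q (by omega)) := by
    have : ∀ x (hx : p + 1 + m = x), app₂ φ.1 (f.1.v (p + 1) (p + 1 + m) rfl)
        (D.d (p + 1 + m) q) = app₂ φ.1 (f.1.v (p + 1) x hx) (D.d x q) := by
      rintro _ rfl; rfl
    simp only [H, Cochain.mk_v, this (p + (m + 1)) (by omega)]
  rw [hm, hH]
  simp only [H, Cochain.mk_v]
  rw [key, Preadditive.comp_neg, Preadditive.neg_comp]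
  abel

lemma charCocycle_eq_zero (φ : cocycles (mult k a) 2)
    (hφ : φ.1 ∈ coboundaries (mult k a) 2) (C : CochainComplex a ℤ) :
    homClass k C C 2 (charCocycle φ C) = 0 := by
  obtain ⟨ψ, hψ⟩ := hφ
  change (linQuiver k a).cochains 1 at ψ
  change differential (mult k a) 1 2 rfl ψ = φ.1 at hψ
  refine homClass_eq_zero C C 2 1 rfl _ (-Cochain.mk fun p q _ => app₁ ψ (C.d p q)) ?_
  have h0 : ∀ X Y : a, app₁ ψ (0 : X ⟶ Y) = 0 := fun X Y =>
    cochain_zero ψ (Chain.nil (Q := linQuiver k a) X) 0 _ (Chain.nil (Q := linQuiver k a) Y)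
  rw [δ_neg]
  ext p q h
  rw [Cochain.neg_v, δ_v 1 2 rfl _ p q h (p + 1) (p + 1) (by omega) rfl,
    charCocycle_v φ C p (p + 1) q rfl h, ← hψ, differential_chain₂, C.d_comp_d, h0]
  simp only [Cochain.mk_v, Int.negOnePow_even 2 ⟨1, rfl⟩, one_smul]
  abel

/-- The characteristic morphism on Hochschild cocycles. -/
def characteristicCocycles :
    cocycles (mult k a) 2 →ₗ[k] gradedCentre k (HomotopyCategory a (.up ℤ)) 2 where
  toFun φ := ⟨fun C => homClass k C.as C.as 2 (charCocycle φ C.as), fun m X Y f => by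
    obtain ⟨z, rfl⟩ := homClass_surjective (k := k) X.as Y.as m f
    exact charCocycle_comm φ X.as Y.as m z⟩
  map_add' φ ψ := by
    ext C
    change _ = homClass k C.as C.as 2 _ + homClass k C.as C.as 2 _
    rw [← map_add]
    change homClass k C.as C.as 2 _ = _
    congr 1
    ext p q h
    change (characteristicDg k a 2 (φ.1 + ψ.1) C.as).v p q h = _
    rw [map_add]
    rfl
  map_smul' r φ := by
    ext C
    change _ = r • homClass k C.as C.as 2 _
    rw [← map_smul]
    change homClass k C.as C.as 2 _ = _
    congr 1
    ext p q h
    change (characteristicDg k a 2 (r • φ.1) C.as).v p q h = _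
    rw [map_smul]
    rfl

/-- The characteristic morphism `χ_a : HH²(a) → 𝔷²K(a)`, induced on cohomology by the characteristic dg
morphism. -/
def characteristicMorphism :
    HH (mult k a) 2 →ₗ[k] gradedCentre k (HomotopyCategory a (.up ℤ)) 2 :=
  Submodule.liftQ _ characteristicCocycles fun φ hφ => by
    refine Subtype.ext (funext fun C => ?_)
    exact charCocycle_eq_zero φ hφ C.as

/-- The obstruction class in `K(a)(C, C[2])` of a graded lift: the class of the cocycle `u` for which
the curvature of the graded lift is `u ε`. -/
def GradedLift.obstruction {φ : cocycles (mult k a) 2} {C : CochainComplex a ℤ}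
    (L : GradedLift φ C) :
    ShiftedHom ((HomotopyCategory.quotient a (.up ℤ)).obj C)
      ((HomotopyCategory.quotient a (.up ℤ)).obj C) (2 : ℤ) :=
  homClass k C C 2 L.cocycle

end Characteristic

end HochChar

end

/-!
The `ε`-coefficient of a graded lift of `C` is an arbitrary cochain `β` of degree one on `C`, and
with the composition `m + φ ε` of `a_φ[ε]` its curvature is
`-(δ_C + β ε)² = (-φ(δ_C, δ_C) - (δ_C β + β δ_C)) ε`. So the curvature cocycles of the graded lifts
of `C` make up exactly the cohomology class of `-φ(δ_C, δ_C)`; in particular `C` has a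
graded lift of curvature zero if and only if this class vanishes. As the classes `χ(c)_C` form an
element of the graded centre, their vanishing is invariant under isomorphisms in `K(a)`, so lifts up
to homotopy equivalence give nothing more.
-/

namespace HochChar

open CochainComplex.HomComplex

section Centre

variable {k : Type w} [CommRing k] {T : Type u} [Category.{v} T] [Preadditive T] [Linear k T]
  [HasShift T ℤ] [∀ n : ℤ, (shiftFunctor T n).Additive] [∀ n : ℤ, (shiftFunctor T n).Linear k]

lemma gradedCentre_naturality {n : ℤ} (ζ : gradedCentre k T n) {X Y : T} (f : X ⟶ Y) :
    f ≫ ζ.1 Y = ζ.1 X ≫ f⟦n⟧' := by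
  have comm_degree_zero : ∀ (l : ℤ) (h₁ : n + 0 = l) (h₂ : 0 + n = l),
      (ShiftedHom.mk₀ 0 rfl f).comp (ζ.1 Y) h₁ =
        (0 * n).negOnePow • (ζ.1 X).comp (ShiftedHom.mk₀ 0 rfl f) h₂ := by
    rintro _ _ rfl
    exact ζ.2 0 X Y (ShiftedHom.mk₀ 0 rfl f)
  simpa [ShiftedHom.mk₀_comp, ShiftedHom.comp_mk₀] using
    comm_degree_zero n (add_zero n) (zero_add n)

lemma gradedCentre_apply_eq_zero_iff_of_iso {n : ℤ} (ζ : gradedCentre k T n) {X Y : T}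
    (e : X ≅ Y) : ζ.1 X = 0 ↔ ζ.1 Y = 0 := by
  rw [← Preadditive.IsIso.comp_left_eq_zero e.hom (ζ.1 Y), gradedCentre_naturality,
    Preadditive.IsIso.comp_right_eq_zero]

end Centre

section Obstruction

variable {k : Type w} [CommRing k] {a : Type u} [Category.{v} a] [Preadditive a] [Linear k a]

lemma homClass_eq_toHom_comp (K L : CochainComplex a ℤ) (n : ℤ) (z : Cocycle K L n) :
    homClass k K L n z = (CohomologyClass.mk z).toHom ≫
      ((HomotopyCategory.quotient a (.up ℤ)).commShiftIso n).hom.app L := by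
  rw [CohomologyClass.toHom_mk]
  rfl

lemma homClass_eq_iff (K L : CochainComplex a ℤ) {n m : ℤ} (hm : m + 1 = n) (z w : Cocycle K L n) :
    homClass k K L n z = homClass k K L n w ↔
      ∃ β : Cochain K L m, δ m n β = (z : Cochain K L n) - w := by
  rw [homClass_eq_toHom_comp, homClass_eq_toHom_comp, cancel_mono,
    (CohomologyClass.toHom_bijective K L n).injective.eq_iff, ← sub_eq_zero,
    ← CohomologyClass.mk_sub, CohomologyClass.mk_eq_zero_iff, mem_coboundaries_iff _ m hm,
    Cocycle.coe_sub]

variable {φ : GradedQuiver.cocycles (mult k a) 2} {C : CochainComplex a ℤ}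

namespace GradedLift

lemma coeff₀_d (L : GradedLift φ C) (i j : ℤ) : (L.d i j).coeff₀ = C.d i j := L.reduction_d i j

/-- The coefficient of `ε` in a graded lift. -/
def coeff₁ (L : GradedLift φ C) : Cochain C C 1 :=
  Cochain.mk fun p q _ => (L.d p q).coeff₁

variable (φ) in
/-- The graded lift `d + β ε`. -/
def ofCoeff₁ (β : Cochain C C 1) : GradedLift φ C where
  d i j := ⟨C.d i j, if h : i + 1 = j then β.v i j h else 0⟩
  shape i j h := Deformation.hom_ext (C.shape i j h) (dif_neg h)
  reduction_d _ _ := rfl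

lemma coeff₁_ofCoeff₁ (β : Cochain C C 1) : (ofCoeff₁ φ β).coeff₁ = β := by
  ext p q h
  exact dif_pos h

lemma coe_cocycle_eq_charCocycle_sub_δ (L : GradedLift φ C) :
    (L.cocycle : Cochain C C 2) = charCocycle φ C - δ 1 2 L.coeff₁ := by
  ext p q h
  rw [Cochain.sub_v, charCocycle_v φ C p (p + 1) q rfl h,
    δ_v 1 2 rfl _ p q h (p + 1) (p + 1) (by omega) rfl]
  simp only [cocycle, curvature, coeff₁, Cocycle.mk_coe, Cochain.mk_v, Deformation.neg_coeff₁,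
    Deformation.comp_coeff₁, coeff₀_d, Int.negOnePow_even 2 even_two, one_smul]
  abel

lemma obstruction_eq_homClass_charCocycle (L : GradedLift φ C) :
    L.obstruction = homClass k C C 2 (charCocycle φ C) := by
  refine ((homClass_eq_iff C C one_add_one_eq_two _ _).2 ⟨L.coeff₁, ?_⟩).symm
  rw [coe_cocycle_eq_charCocycle_sub_δ, sub_sub_cancel]

lemma exists_cocycle_eq_iff (z : Cocycle C C 2) :
    (∃ L : GradedLift φ C, L.cocycle = z) ↔
      homClass k C C 2 (charCocycle φ C) = homClass k C C 2 z := by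
  constructor
  · rintro ⟨L, rfl⟩
    exact L.obstruction_eq_homClass_charCocycle.symm
  · intro h
    obtain ⟨β, hβ⟩ := (homClass_eq_iff C C one_add_one_eq_two _ _).1 h
    refine ⟨ofCoeff₁ φ β, Subtype.ext ?_⟩
    rw [coe_cocycle_eq_charCocycle_sub_δ, coeff₁_ofCoeff₁, hβ, sub_sub_cancel]

lemma d_comp_d_of_cocycle_eq_zero (L : GradedLift φ C) (hL : L.cocycle = 0) {p q r : ℤ}
    (hpq : p + 1 = q) (hqr : q + 1 = r) : L.d p q ≫ L.d q r = 0 := by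
  subst hpq
  ext
  · simp only [Deformation.comp_coeff₀, coeff₀_d, C.d_comp_d, Deformation.zero_coeff₀]
  · have curvature_coeff₁ : -(L.d p (p + 1) ≫ L.d (p + 1) r).coeff₁ = 0 :=
      Cochain.congr_v (congrArg Subtype.val hL) p r (by omega)
    exact neg_eq_zero.1 curvature_coeff₁

/-- A graded lift of curvature zero as a complex over the deformation. -/
def toComplex (L : GradedLift φ C) (hL : L.cocycle = 0) :
    CochainComplex (Deformation φ) ℤ where
  X i := ⟨C.X i⟩
  d := L.d
  shape := L.shape
  d_comp_d' _ _ _ := L.d_comp_d_of_cocycle_eq_zero hL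

/-- The complex defined by a graded lift of `C` of curvature zero reduces to `C` modulo `ε`. -/
def reductionToComplexIso (L : GradedLift φ C) (hL : L.cocycle = 0) :
    ((Deformation.reduction φ).mapHomologicalComplex (.up ℤ)).obj (L.toComplex hL) ≅ C :=
  HomologicalComplex.Hom.isoOfComponents (fun i => Iso.refl (C.X i)) fun i j _ =>
    (Category.id_comp _).trans ((L.reduction_d i j).symm.trans (Category.comp_id _).symm)

/-- The differential of a complex over the deformation as a graded lift of its reduction. -/
def ofComplex (D : CochainComplex (Deformation φ) ℤ) :
    GradedLift φ (((Deformation.reduction φ).mapHomologicalComplex (.up ℤ)).obj D) where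
  d := D.d
  shape := D.shape
  reduction_d _ _ := rfl

lemma cocycle_ofComplex (D : CochainComplex (Deformation φ) ℤ) : (ofComplex D).cocycle = 0 := by
  ext p q h
  change (-(D.d p (p + 1) ≫ D.d (p + 1) q)).coeff₁ = 0
  rw [D.d_comp_d, neg_zero, Deformation.zero_coeff₁]

end GradedLift

lemma homClass_charCocycle_eq_zero_iff_exists_flat :
    homClass k C C 2 (charCocycle φ C) = 0 ↔ ∃ L : GradedLift φ C, L.cocycle = 0 := by
  rw [GradedLift.exists_cocycle_eq_iff, map_zero]

lemma characteristicMorphism_mk_apply (φ : GradedQuiver.cocycles (mult k a) 2)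
    (C : HomotopyCategory a (.up ℤ)) :
    (characteristicMorphism (GradedQuiver.HH.mk (mult k a) 2 φ)).1 C =
      homClass k C.as C.as 2 (charCocycle φ C.as) :=
  rfl

lemma characteristicMorphism_mk_apply_eq_obstruction {C : HomotopyCategory a (.up ℤ)}
    (L : GradedLift φ C.as) :
    (characteristicMorphism (GradedQuiver.HH.mk (mult k a) 2 φ)).1 C = L.obstruction :=
  L.obstruction_eq_homClass_charCocycle.symm

lemma characteristicMorphism_mk_apply_eq_zero_iff (φ : GradedQuiver.cocycles (mult k a) 2)
    (C : HomotopyCategory a (.up ℤ)) :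
    (characteristicMorphism (GradedQuiver.HH.mk (mult k a) 2 φ)).1 C = 0 ↔
      ∃ D : HomotopyCategory (Deformation φ) (.up ℤ),
        Nonempty (((Deformation.reduction φ).mapHomotopyCategory (.up ℤ)).obj D ≅ C) := by
  constructor
  · intro h
    obtain ⟨L, hL⟩ := homClass_charCocycle_eq_zero_iff_exists_flat.1 h
    exact ⟨(HomotopyCategory.quotient _ _).obj (L.toComplex hL),
      ⟨(HomotopyCategory.quotient _ _).mapIso (L.reductionToComplexIso hL)⟩⟩
  · rintro ⟨D, ⟨e⟩⟩
    rw [← gradedCentre_apply_eq_zero_iff_of_iso _ e, characteristicMorphism_mk_apply]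
    exact homClass_charCocycle_eq_zero_iff_exists_flat.2
      ⟨.ofComplex D.as, GradedLift.cocycle_ofComplex D.as⟩

end Obstruction

end HochChar

theorem mainTheorem1_general {k : Type w} [CommRing k] {a : Type u} [Category.{v} a] [Preadditive a]
    [Linear k a] :
    (∀ (φ : (HochChar.linQuiver k a).cochains 2) (C : CochainComplex a ℤ) (p q r : ℤ)
      (_ : p + 1 = q) (_ : q + 1 = r) (hpr : p + 2 = r),
      (HochChar.characteristicDg k a 2 φ C).v p r hpr =
        -HochChar.app₂ φ (C.d p q) (C.d q r)) ∧
    ∀ (c : HochChar.GradedQuiver.HH (HochChar.mult k a) 2)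
      (φ : HochChar.GradedQuiver.cocycles (HochChar.mult k a) 2),
      HochChar.GradedQuiver.HH.mk (HochChar.mult k a) 2 φ = c →
      ∀ C : HomotopyCategory a (ComplexShape.up ℤ),
        Nonempty (HochChar.GradedLift φ C.as) ∧
        (∀ L : HochChar.GradedLift φ C.as,
          (HochChar.characteristicMorphism c).1 C = L.obstruction) ∧
        ((HochChar.characteristicMorphism c).1 C = 0 ↔
          ∃ D : HomotopyCategory (HochChar.Deformation φ) (ComplexShape.up ℤ),
            Nonempty (((HochChar.Deformation.reduction φ).mapHomotopyCategory
              (ComplexShape.up ℤ)).obj D ≅ C)) := by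
  constructor
  · rintro φ C p _ r rfl _ hpr
    exact HochChar.characteristicDg_two φ C p r hpr
  · rintro _ φ rfl C
    exact ⟨⟨HochChar.GradedLift.trivial φ C.as⟩,
      HochChar.characteristicMorphism_mk_apply_eq_obstruction,
      HochChar.characteristicMorphism_mk_apply_eq_zero_iff φ C⟩

theorem mainTheorem1 {k : Type w} [Field k] {a : Type u} [Category.{v} a] [Preadditive a]
    [Linear k a] :
    (∀ (φ : (HochChar.linQuiver k a).cochains 2) (C : CochainComplex a ℤ) (p q r : ℤ)
      (_ : p + 1 = q) (_ : q + 1 = r) (hpr : p + 2 = r),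
      (HochChar.characteristicDg k a 2 φ C).v p r hpr =
        -HochChar.app₂ φ (C.d p q) (C.d q r)) ∧
    ∀ (c : HochChar.GradedQuiver.HH (HochChar.mult k a) 2)
      (φ : HochChar.GradedQuiver.cocycles (HochChar.mult k a) 2),
      HochChar.GradedQuiver.HH.mk (HochChar.mult k a) 2 φ = c →
      ∀ C : HomotopyCategory a (ComplexShape.up ℤ),
        Nonempty (HochChar.GradedLift φ C.as) ∧
        (∀ L : HochChar.GradedLift φ C.as,
          (HochChar.characteristicMorphism c).1 C = L.obstruction) ∧
        ((HochChar.characteristicMorphism c).1 C = 0 ↔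
          ∃ D : HomotopyCategory (HochChar.Deformation φ) (ComplexShape.up ℤ),
            Nonempty (((HochChar.Deformation.reduction φ).mapHomotopyCategory
              (ComplexShape.up ℤ)).obj D ≅ C)) :=
  mainTheorem1_general
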